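/- Let $N\ge 1$, $1\le k\le N$ and $\gamma\in\mathbb{R}\setminus\{0\}$. Consider the uniform XX chain of $N$ spins-$\tfrac12$ with nearest-neighbour coupling, $H_s=\frac{\gamma}{2}\sum_{n=1}^{N-1}(X_nX_{n+1}+Y_nY_{n+1})$, with local control $H_c=Z_k$, where $X_n,Y_n,Z_n$ are the Pauli operators acting on spin $n$. Both operators leave invariant the single-excitation subspace $\mathcal{H}_1$, spanned by the states $|n\rangle$, $n=1,\dots,N$, in which spin $n$ is down and all the others are up. Let $H_0$ and $H_1$ be the $N\times N$ matrices of their restrictions to $\mathcal{H}_1$ in this basis. The dynamical Lie algebra of two Hermitian $N\times N$ matrices $A,B$ is the real Lie algebra generated by $iA$ and $iB$; the system is called controllable on $\mathcal{H}_1$ if the dynamical Lie algebra of $H_0,H_1$ is $\mathfrak{u}(N)$ or $\mathfrak{su}(N)$. An external symmetry of a pair of Hermitian matrices is a Hermitian matrix that commutes with both and is not a multiple of the identity. Then: 1. The system is controllable on $\mathcal{H}_1$ if and only if $\gcd(N+1,k)=1$. 2. The dynamical Lie algebra of $H_0$ and $|k\rangle\langle k|$ (that is, with control $z_k=i|k\rangle\langle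 k|$) equals $\mathfrak{u}(N)$ if and only if $\gcd(N+1,k)=1$. 3. The pair $(H_0,H_1)$ has no external symmetry if and only if $\gcd(N+1,k)=1$; the same holds for the pair $(H_0,|k\rangle\langle k|)$. 4. For $j=1,\dots,N$ the vector $v_j$ with entries $v_{nj}=\sin\frac{nj\pi}{N+1}$, $n=1,\dots,N$, is an eigenvector of $H_0$ with eigenvalue $2\gamma\cos\frac{j\pi}{N+1}$, and every eigenvector of $H_0$ is a scalar multiple of some $v_j$. There is $j\in\{1,\dots,N\}$ with $v_{kj}=\sin\frac{kj\pi}{N+1}=0$ if and only if $\gcd(N+1,k)>1$. -/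

import Mathlib

open scoped Matrix

attribute [local instance 100] LieRing.ofAssociativeRing

noncomputable section

namespace SpinChain

/-- The Pauli matrices; index `0` is spin up, index `1` is spin down. -/
def pauliX : Matrix (Fin 2) (Fin 2) ℂ := !![0, 1; 1, 0]
def pauliY : Matrix (Fin 2) (Fin 2) ℂ := !![0, -Complex.I; Complex.I, 0]
def pauliZ : Matrix (Fin 2) (Fin 2) ℂ := !![1, 0; 0, -1]

/-- The computational basis of the `N`-spin Hilbert space is indexed by spin configurations. -/
abbrev Config (N : ℕ) : Type := Fin N → Fin 2

/-- The operator acting as `A` on spin `n` and as the identity on every other spin: the `N`-fold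
tensor product of matrices whose `n`-th factor is `A`, all the others being the identity. -/
def siteOp {N : ℕ} (A : Matrix (Fin 2) (Fin 2) ℂ) (n : Fin N) :
    Matrix (Config N) (Config N) ℂ :=
  fun σ τ => ∏ m, (if m = n then A else 1) (σ m) (τ m)

/-- The Hamiltonian `½ ∑_{m<n} γ_{mn} (X_m X_n + Y_m Y_n + κ Z_m Z_n)` of an XXZ network. -/
def xxzHamiltonian {N : ℕ} (γ : Fin N → Fin N → ℝ) (κ : ℝ) :
    Matrix (Config N) (Config N) ℂ :=
  (1 / 2 : ℂ) • ∑ m : Fin N, ∑ n : Fin N,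
    if m < n then
      (γ m n : ℂ) • (siteOp pauliX m * siteOp pauliX n + siteOp pauliY m * siteOp pauliY n
        + (κ : ℂ) • (siteOp pauliZ m * siteOp pauliZ n))
    else 0

/-- Couplings of the uniform chain: `g` between neighbours, `0` otherwise. -/
def chainCoupling {N : ℕ} (g : ℝ) (m n : Fin N) : ℝ :=
  if (m : ℕ) + 1 = n ∨ (n : ℕ) + 1 = m then g else 0

/-- The uniform XX chain (`κ = 0`) of length `N` with coupling strength `g`. -/
def xxChain (N : ℕ) (g : ℝ) : Matrix (Config N) (Config N) ℂ :=
  xxzHamiltonian (chainCoupling g) 0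

/-- The single-excitation basis state `|k⟩`: spin `k` is down, all the others are up. -/
def excitation {N : ℕ} (k : Fin N) : Config N := Pi.single k 1

/-- The total spin `∑ Z_n` read off a configuration. -/
def totalSpin {N : ℕ} (σ : Config N) : ℂ := ∑ m, pauliZ (σ m) (σ m)

theorem siteOp_pauliZ {N : ℕ} (n : Fin N) :
    siteOp pauliZ n = Matrix.diagonal fun σ : Config N => pauliZ (σ n) (σ n) := by
  ext σ τ
  by_cases h : σ = τ
  · subst h
    simp only [siteOp, Matrix.diagonal_apply_eq]
    rw [Finset.prod_eq_single n]
    · simp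
    · intro m _ hm
      simp [hm]
    · simp
  · rw [Matrix.diagonal_apply_ne _ h]
    obtain ⟨m, hm⟩ := Function.ne_iff.mp h
    refine Finset.prod_eq_zero (Finset.mem_univ m) ?_
    by_cases hmn : m = n
    · simp only [hmn, if_true]
      rw [hmn] at hm
      revert hm
      generalize σ n = a
      generalize τ n = b
      fin_cases a <;> fin_cases b <;> simp [pauliZ]
    · simp [hmn, hm]

theorem siteOp_mul_self {N : ℕ} (A B : Matrix (Fin 2) (Fin 2) ℂ) (n : Fin N) :
    siteOp A n * siteOp B n = siteOp (A * B) n := by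
  ext σ τ
  simp only [Matrix.mul_apply, siteOp, ← Finset.prod_mul_distrib]
  rw [← Fintype.prod_sum (fun m a => (if m = n then A else 1) (σ m) a *
    (if m = n then B else 1) a (τ m))]
  refine Finset.prod_congr rfl fun m _ => ?_
  by_cases h : m = n <;> simp [h, Matrix.mul_apply, Matrix.one_apply]

theorem siteOp_comm {N : ℕ} (A B : Matrix (Fin 2) (Fin 2) ℂ) {m n : Fin N} (hmn : m ≠ n) :
    siteOp A m * siteOp B n = siteOp B n * siteOp A m := by
  ext σ τ
  simp only [Matrix.mul_apply, siteOp, ← Finset.prod_mul_distrib]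
  rw [← Fintype.prod_sum (fun l a => (if l = m then A else 1) (σ l) a *
    (if l = n then B else 1) a (τ l)), ← Fintype.prod_sum (fun l a =>
    (if l = n then B else 1) (σ l) a * (if l = m then A else 1) a (τ l))]
  refine Finset.prod_congr rfl fun l _ => ?_
  by_cases h : l = m
  · have : l ≠ n := fun h' => hmn (h ▸ h')
    simp [h, hmn, Matrix.one_apply]
  · by_cases h' : l = n <;> simp [h, h', Ne.symm hmn, Matrix.one_apply]

theorem sum_siteOp_pauliZ {N : ℕ} :
    ∑ l : Fin N, siteOp pauliZ l = Matrix.diagonal (totalSpin : Config N → ℂ) := by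
  simp only [siteOp_pauliZ]
  ext σ τ
  simp only [Matrix.sum_apply, Matrix.diagonal_apply, totalSpin]
  split_ifs <;> simp

theorem siteOp_smul {N : ℕ} (c : ℂ) (A : Matrix (Fin 2) (Fin 2) ℂ) (n : Fin N) :
    siteOp (c • A) n = c • siteOp A n := by
  ext σ τ
  simp only [siteOp, Matrix.smul_apply, smul_eq_mul]
  rw [← Finset.mul_prod_erase _ _ (Finset.mem_univ n),
    ← Finset.mul_prod_erase (a := n) _ _ (Finset.mem_univ n)]
  simp only [if_true, Matrix.smul_apply, smul_eq_mul, mul_assoc]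
  congr 2
  refine Finset.prod_congr rfl fun m hm => ?_
  simp [Finset.ne_of_mem_erase hm]

theorem pauliZ_mul_pauliX : pauliZ * pauliX = Complex.I • pauliY := by
  ext a b; fin_cases a <;> fin_cases b <;> simp [pauliX, pauliY, pauliZ]

theorem pauliX_mul_pauliZ : pauliX * pauliZ = (-Complex.I) • pauliY := by
  ext a b; fin_cases a <;> fin_cases b <;> simp [pauliX, pauliY, pauliZ]

theorem pauliZ_mul_pauliY : pauliZ * pauliY = (-Complex.I) • pauliX := by
  ext a b; fin_cases a <;> fin_cases b <;> simp [pauliX, pauliY, pauliZ]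

theorem pauliY_mul_pauliZ : pauliY * pauliZ = Complex.I • pauliX := by
  ext a b; fin_cases a <;> fin_cases b <;> simp [pauliX, pauliY, pauliZ]

theorem commute_coupling_aux {R : Type*} [Ring R] [Module ℂ R] [IsScalarTower ℂ R R]
    [SMulCommClass ℂ R R] {x y z x' y' z' : R}
    (c1 : z * x' = x' * z) (c2 : z * y' = y' * z) (c3 : x * z' = z' * x) (c4 : y * z' = z' * y)
    (e1 : z * x = Complex.I • y) (e2 : x * z = (-Complex.I) • y)
    (e3 : z * y = (-Complex.I) • x) (e4 : y * z = Complex.I • x)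
    (e1' : z' * x' = Complex.I • y') (e2' : x' * z' = (-Complex.I) • y')
    (e3' : z' * y' = (-Complex.I) • x') (e4' : y' * z' = Complex.I • x') :
    Commute (z + z') (x * x' + y * y') := by
  rw [commute_iff_eq]
  simp only [add_mul, mul_add]
  rw [← mul_assoc z, ← mul_assoc z, ← mul_assoc z', ← mul_assoc z', e1, e3, ← c3, ← c4,
    mul_assoc x z', mul_assoc y z', e1', e3', mul_assoc x x' z, mul_assoc y y' z, ← c1, ← c2,
    mul_assoc x x' z', mul_assoc y y' z', e2', e4', ← mul_assoc x z, ← mul_assoc y z, e2, e4]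
  simp only [neg_smul, neg_mul, mul_neg, smul_mul_assoc, mul_smul_comm]
  abel

/-- The total spin operator commutes with each coupling term. -/
theorem commute_coupling {N : ℕ} {m n : Fin N} (h : m ≠ n) :
    Commute (∑ l : Fin N, siteOp pauliZ l)
      (siteOp pauliX m * siteOp pauliX n + siteOp pauliY m * siteOp pauliY n) := by
  have e1 (l : Fin N) : siteOp pauliZ l * siteOp pauliX l = Complex.I • siteOp pauliY l := by
    rw [siteOp_mul_self, pauliZ_mul_pauliX, siteOp_smul]
  have e2 (l : Fin N) : siteOp pauliX l * siteOp pauliZ l = (-Complex.I) • siteOp pauliY l := by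
    rw [siteOp_mul_self, pauliX_mul_pauliZ, siteOp_smul]
  have e3 (l : Fin N) : siteOp pauliZ l * siteOp pauliY l = (-Complex.I) • siteOp pauliX l := by
    rw [siteOp_mul_self, pauliZ_mul_pauliY, siteOp_smul]
  have e4 (l : Fin N) : siteOp pauliY l * siteOp pauliZ l = Complex.I • siteOp pauliX l := by
    rw [siteOp_mul_self, pauliY_mul_pauliZ, siteOp_smul]
  have key := commute_coupling_aux (siteOp_comm pauliZ pauliX h) (siteOp_comm pauliZ pauliY h)
    (siteOp_comm pauliX pauliZ h) (siteOp_comm pauliY pauliZ h) (e1 m) (e2 m) (e3 m) (e4 m)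
    (e1 n) (e2 n) (e3 n) (e4 n)
  rw [← Finset.add_sum_erase _ _ (Finset.mem_univ m),
    ← Finset.add_sum_erase _ _ (Finset.mem_erase.mpr ⟨h.symm, Finset.mem_univ n⟩), ← add_assoc]
  refine key.add_left (Commute.sum_left _ _ _ fun l hl => ?_)
  have hn : l ≠ n := Finset.ne_of_mem_erase hl
  have hm : l ≠ m := Finset.ne_of_mem_erase (Finset.mem_of_mem_erase hl)
  exact (Commute.mul_right (siteOp_comm _ _ hm) (siteOp_comm _ _ hn)).add_right
    (Commute.mul_right (siteOp_comm _ _ hm) (siteOp_comm _ _ hn))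

theorem excitation_apply {N : ℕ} (k m : Fin N) :
    (excitation k : Config N) m = if m = k then 1 else 0 := by
  simp [excitation, Pi.single_apply]

theorem totalSpin_eq {N : ℕ} (σ : Config N) :
    totalSpin σ = (N : ℂ) - 2 * ((Finset.univ.filter fun m => σ m = 1).card : ℂ) := by
  have h (a : Fin 2) : pauliZ a a = 1 - 2 * (if a = 1 then (1 : ℂ) else 0) := by
    fin_cases a <;> norm_num [pauliZ]
  simp only [totalSpin, h, Finset.sum_sub_distrib, ← Finset.mul_sum, Finset.sum_boole]
  simp

/-- The single-excitation configurations are those of total spin `N - 2`. -/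
theorem exists_excitation_of_totalSpin {N : ℕ} {σ : Config N} {k : Fin N}
    (h : totalSpin σ = totalSpin (excitation k)) : ∃ l, σ = excitation l := by
  rw [totalSpin_eq, totalSpin_eq] at h
  have hk : (Finset.univ.filter fun m => (excitation k : Config N) m = 1) = {k} := by
    ext m
    rw [Finset.mem_filter, Finset.mem_singleton, excitation_apply]
    by_cases hm : m = k <;> simp [hm]
  rw [hk] at h
  have h1 : (Finset.univ.filter fun m => σ m = 1).card = 1 := by
    have : ((Finset.univ.filter fun m => σ m = 1).card : ℂ) = 1 := by
      simp only [Finset.card_singleton, Nat.cast_one] at h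
      linear_combination (-1 / 2 : ℂ) * h
    exact_mod_cast this
  obtain ⟨l, hl⟩ := Finset.card_eq_one.mp h1
  refine ⟨l, funext fun m => ?_⟩
  have hm : σ m = 1 ↔ m = l := by
    simpa using Finset.ext_iff.mp hl m
  by_cases hml : m = l
  · rw [hm.mpr hml, hml]; simp [excitation]
  · have h0 : σ m ≠ 1 := fun h' => hml (hm.mp h')
    have : σ m = 0 := by omega
    simp [excitation, hml, this]

/-- Every XXZ Hamiltonian maps the single-excitation subspace into itself. -/
theorem xxzHamiltonian_invariant {N : ℕ} (γ : Fin N → Fin N → ℝ) (κ : ℝ) (k : Fin N)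
    (σ : Config N) (hσ : ¬ ∃ l, σ = excitation l) :
    xxzHamiltonian γ κ σ (excitation k) = 0 := by
  have hc : Commute (∑ l : Fin N, siteOp pauliZ l) (xxzHamiltonian γ κ) := by
    refine Commute.smul_right (Commute.sum_right _ _ _ fun m _ => Commute.sum_right _ _ _
      fun n _ => ?_) _
    split_ifs with h
    · refine Commute.smul_right ((commute_coupling h.ne).add_right (Commute.smul_right ?_ _)) _
      rw [sum_siteOp_pauliZ, siteOp_pauliZ, siteOp_pauliZ, Matrix.diagonal_mul_diagonal,
        commute_iff_eq, Matrix.diagonal_mul_diagonal, Matrix.diagonal_mul_diagonal]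
      simp only [mul_comm]
    · exact Commute.zero_right _
  rw [sum_siteOp_pauliZ, commute_iff_eq] at hc
  have := congrFun (congrFun hc σ) (excitation k)
  rw [Matrix.diagonal_mul, Matrix.mul_diagonal] at this
  by_contra hne
  refine hσ (exists_excitation_of_totalSpin (k := k) (mul_right_cancel₀ hne ?_))
  rw [this, mul_comm]

/-- The control `Z_n` maps the single-excitation subspace into itself. -/
theorem siteOp_pauliZ_invariant {N : ℕ} (n k : Fin N)
    (σ : Config N) (hσ : ¬ ∃ l, σ = excitation l) :
    siteOp pauliZ n σ (excitation k) = 0 := by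
  rw [siteOp_pauliZ, Matrix.diagonal_apply_ne]
  exact fun h => hσ ⟨k, h⟩

/-- The matrix, in the basis `|1⟩, …, |N⟩`, of an operator restricted to the single-excitation
subspace. (All operators below leave this subspace invariant: see `xxzHamiltonian_invariant`,
`siteOp_pauliZ_invariant`.) -/
def restrict {N : ℕ} (H : Matrix (Config N) (Config N) ℂ) : Matrix (Fin N) (Fin N) ℂ :=
  H.submatrix excitation excitation

/-- The matrix unit `|k⟩⟨k|`, so that `z_k = i |k⟩⟨k|`. -/
def nodeProj {N : ℕ} (k : Fin N) : Matrix (Fin N) (Fin N) ℂ := Matrix.single k k 1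

/-- `𝔲(N)`: the real Lie algebra of skew-Hermitian `N × N` matrices. -/
def uLie (N : ℕ) : LieSubalgebra ℝ (Matrix (Fin N) (Fin N) ℂ) where
  carrier := {A | Aᴴ = -A}
  zero_mem' := by simp
  add_mem' := by
    intro A B hA hB
    simp only [Set.mem_ofPred_eq] at *
    rw [Matrix.conjTranspose_add, hA, hB, neg_add]
  smul_mem' := by
    intro c A hA
    simp only [Set.mem_ofPred_eq] at *
    rw [Matrix.conjTranspose_smul, hA, star_trivial, smul_neg]
  lie_mem' := by
    intro A B hA hB
    have hA' : Aᴴ = -A := hA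
    have hB' : Bᴴ = -B := hB
    change (⁅A, B⁆)ᴴ = -⁅A, B⁆
    simp only [Ring.lie_def, Matrix.conjTranspose_sub, Matrix.conjTranspose_mul, hA', hB']
    noncomm_ring

/-- `𝔰𝔲(N)`: the traceless elements of `𝔲(N)`. -/
def suLie (N : ℕ) : LieSubalgebra ℝ (Matrix (Fin N) (Fin N) ℂ) where
  carrier := {A | A ∈ uLie N ∧ A.trace = 0}
  zero_mem' := ⟨(uLie N).zero_mem, Matrix.trace_zero _ _⟩
  add_mem' := by
    rintro A B ⟨hA, hA0⟩ ⟨hB, hB0⟩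
    exact ⟨(uLie N).add_mem hA hB, by rw [Matrix.trace_add, hA0, hB0, add_zero]⟩
  smul_mem' := by
    rintro c A ⟨hA, hA0⟩
    exact ⟨(uLie N).smul_mem c hA, by rw [Matrix.trace_smul, hA0, smul_zero]⟩
  lie_mem' := by
    rintro A B ⟨hA, _⟩ ⟨hB, _⟩
    refine ⟨(uLie N).lie_mem hA hB, ?_⟩
    rw [Ring.lie_def, Matrix.trace_sub, Matrix.trace_mul_comm, sub_self]

/-- The dynamical Lie algebra of the controlled Hamiltonian `H₀ + f(t) H₁`: the real Lie algebra
generated by `i H₀` and `i H₁`. -/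
def dynLie {N : ℕ} (H₀ H₁ : Matrix (Fin N) (Fin N) ℂ) :
    LieSubalgebra ℝ (Matrix (Fin N) (Fin N) ℂ) :=
  LieSubalgebra.lieSpan ℝ _ {Complex.I • H₀, Complex.I • H₁}

/-- Controllability: the dynamical Lie algebra is `𝔲(N)` or `𝔰𝔲(N)`. -/
def IsControllable {N : ℕ} (H₀ H₁ : Matrix (Fin N) (Fin N) ℂ) : Prop :=
  dynLie H₀ H₁ = uLie N ∨ dynLie H₀ H₁ = suLie N

/-- An external (commutation) symmetry: a Hermitian matrix, not a multiple of the identity, which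
commutes with both Hamiltonians. -/
def HasExternalSymmetry {N : ℕ} (H₀ H₁ : Matrix (Fin N) (Fin N) ℂ) : Prop :=
  ∃ S : Matrix (Fin N) (Fin N) ℂ, S.IsHermitian ∧ Commute H₀ S ∧ Commute H₁ S ∧
    ¬ ∃ c : ℂ, S = c • (1 : Matrix (Fin N) (Fin N) ℂ)

/-- The angle `θ_j = j π / (N + 1)`; the node or mode with index `j : Fin N` has number `j + 1`. -/
def modeAngle {N : ℕ} (j : Fin N) : ℝ := ((j : ℕ) + 1 : ℝ) * Real.pi / ((N : ℝ) + 1)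

/-- The vector with `k`-th entry `sin (k j π / (N + 1))` (both indices numbered from `1`). -/
def modeVector {N : ℕ} (j : Fin N) : Fin N → ℂ :=
  fun k => ((Real.sin (((k : ℕ) + 1 : ℝ) * modeAngle j) : ℝ) : ℂ)

end SpinChain

end

noncomputable section

namespace SpinChain

/-! ### The operators on the single-excitation subspace -/

/-! On the single-excitation subspace the chain is `g` times the adjacency matrix of a path, and
`Z_k` becomes `1 - 2P` with `P = |k⟩⟨k|`. The path has simple spectrum with sine eigenvectors, and
the `j`-th one vanishes at node `k` (both numbered from 1) exactly when `N + 1 ∣ k j`; some `1 ≤ j ≤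
N` achieves this iff `gcd (N + 1, k) > 1`. Everything therefore reduces to whether some mode `v` has
a zero at `k`.

If one does, `v vᵀ` commutes with the chain and with `P`: it is an external symmetry, and
`not_hasExternalSymmetry` shows that this excludes controllability.

If none does, let `K` be a complex Lie algebra containing `H` and `P = e eᵀ`. The vectors `w` with
`w eᵀ` and `e wᵀ` in `K` form an `H`-invariant subspace containing `e`. No eigenvector of `H` is
orthogonal to `e`, so this subspace is everything (`eq_top_of_invariant`), and commutators then
produce every rank-one matrix (`lieSubalgebra_eq_top`). The real statement follows through
`complexification`. With `Z_k` as control, `P` is available only modulo scalars; commutators do not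
see scalars, so at least `𝔰𝔲(N)` is obtained. -/

theorem siteOp_mul_siteOp_apply {N : ℕ} (A B : Matrix (Fin 2) (Fin 2) ℂ) {m n : Fin N}
    (hmn : m ≠ n) (σ τ : Config N) :
    (siteOp A m * siteOp B n) σ τ =
      ∏ l, (if l = m then A else if l = n then B else 1) (σ l) (τ l) := by
  simp only [Matrix.mul_apply, siteOp, ← Finset.prod_mul_distrib]
  rw [← Fintype.prod_sum (fun l a => (if l = m then A else 1) (σ l) a *
    (if l = n then B else 1) a (τ l))]
  refine Finset.prod_congr rfl fun l _ => ?_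
  by_cases h : l = m
  · simp [h, hmn, Matrix.one_apply]
  · simp [h, Matrix.one_apply]

/-- The product of two site operators with vanishing diagonal moves one excitation. -/
theorem siteOp_mul_siteOp_excitation {N : ℕ} (A : Matrix (Fin 2) (Fin 2) ℂ)
    (hA : ∀ i, A i i = 0) {m n : Fin N} (hmn : m ≠ n) (a b : Fin N) :
    (siteOp A m * siteOp A n) (excitation a) (excitation b) =
      if (a = m ∧ b = n) ∨ (a = n ∧ b = m) then A 0 1 * A 1 0 else 0 := by
  rw [siteOp_mul_siteOp_apply A A hmn]
  by_cases hab : a = b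
  · subst hab
    rw [if_neg (by rintro (⟨rfl, h⟩ | ⟨rfl, h⟩) <;> simp_all),
      Finset.prod_eq_zero (Finset.mem_univ m)]
    simp [hA]
  · split_ifs with h
    · rw [← Finset.mul_prod_erase _ _ (Finset.mem_univ m),
        ← Finset.mul_prod_erase _ _ (Finset.mem_erase.mpr ⟨hmn.symm, Finset.mem_univ n⟩),
        Finset.prod_eq_one]
      · simp only [if_true, if_neg hmn.symm, excitation_apply, mul_one]
        rcases h with ⟨rfl, rfl⟩ | ⟨rfl, rfl⟩
        · simp [hmn, hmn.symm, mul_comm]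
        · simp [hmn, hmn.symm]
      · intro l hl
        have hn : l ≠ n := Finset.ne_of_mem_erase hl
        have hm : l ≠ m := Finset.ne_of_mem_erase (Finset.mem_of_mem_erase hl)
        have h1 : l ≠ a := by rintro rfl; rcases h with h | h <;> simp_all
        have h2 : l ≠ b := by rintro rfl; rcases h with h | h <;> simp_all
        rw [if_neg hm, if_neg hn, excitation_apply, excitation_apply, if_neg h1, if_neg h2,
          Matrix.one_apply_eq]
    -- Some excited site lies outside `{m, n}`. Since `a ≠ b`, the two configurations differ there,
    -- and the identity factor at that site kills the product.
    · have : ∃ l, l ≠ m ∧ l ≠ n ∧ (l = a ∨ l = b) := by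
        by_cases h1 : a = m ∨ a = n
        · refine ⟨b, ?_, ?_, Or.inr rfl⟩ <;> rintro rfl <;> rcases h1 with rfl | rfl <;> simp_all
        · push Not at h1
          exact ⟨a, h1.1, h1.2, Or.inl rfl⟩
      obtain ⟨l, hm, hn, hl⟩ := this
      refine Finset.prod_eq_zero (Finset.mem_univ l) ?_
      rcases hl with rfl | rfl
      · simp [hm, hn, excitation_apply, hab]
      · simp [hm, hn, excitation_apply, Ne.symm hab]

theorem restrict_xxChain (N : ℕ) (g : ℝ) :
    restrict (xxChain N g) = Matrix.of fun a b => ((chainCoupling g a b : ℝ) : ℂ) := by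
  ext a b
  have hX : ∀ i, pauliX i i = 0 := by intro i; fin_cases i <;> simp [pauliX]
  have hY : ∀ i, pauliY i i = 0 := by intro i; fin_cases i <;> simp [pauliY]
  -- The `2` is one hop from `XX` plus one from `YY`; the prefactor `1 / 2` of the Hamiltonian
  -- cancels it. Of the two summands only the one matching the order of `a` and `b` survives.
  have hterm (m n : Fin N) : (if m < n then
      (chainCoupling g m n : ℂ) • (siteOp pauliX m * siteOp pauliX n
        + siteOp pauliY m * siteOp pauliY n
        + ((0 : ℝ) : ℂ) • (siteOp pauliZ m * siteOp pauliZ n))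
      else 0) (excitation a) (excitation b) =
      (if m = a then if n = b then if a < b then 2 * (chainCoupling g a b : ℂ) else 0 else 0 else 0)
      + (if m = b then if n = a then if b < a then 2 * (chainCoupling g a b : ℂ) else 0
        else 0 else 0) := by
    have hsymm : chainCoupling g b a = chainCoupling g a b := by
      simp only [chainCoupling, or_comm]
    by_cases hmn : m < n
    · rw [if_pos hmn]
      simp only [Complex.ofReal_zero, zero_smul, add_zero, Matrix.smul_apply, Matrix.add_apply,
        siteOp_mul_siteOp_excitation _ hX hmn.ne, siteOp_mul_siteOp_excitation _ hY hmn.ne]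
      have h1 : pauliX 0 1 * pauliX 1 0 = 1 := by simp [pauliX]
      have h2 : pauliY 0 1 * pauliY 1 0 = 1 := by simp [pauliY]
      rw [h1, h2]
      by_cases h : a = m ∧ b = n
      · obtain ⟨rfl, rfl⟩ := h
        simp [hmn, hmn.ne]; ring
      · by_cases h' : a = n ∧ b = m
        · obtain ⟨rfl, rfl⟩ := h'
          simp [hmn, hmn.ne, hsymm]; ring
        · rw [if_neg (by tauto)]
          split_ifs <;> simp_all
    · rw [if_neg hmn]
      split_ifs <;> simp_all
  simp only [restrict, Matrix.submatrix_apply, xxChain, xxzHamiltonian, Matrix.smul_apply,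
    Matrix.sum_apply, hterm, Finset.sum_add_distrib, Matrix.of_apply]
  simp only [Finset.sum_ite_eq', Finset.sum_ite_irrel, Finset.sum_const_zero, Finset.mem_univ,
    if_true, smul_eq_mul]
  rcases lt_trichotomy a b with h | rfl | h
  · simp [h, h.not_gt]
  · simp [chainCoupling]
  · simp [h, h.not_gt]

/-- This affine relation is what makes the two forms of the control comparable: they differ by a
factor and a scalar matrix. -/
theorem restrict_siteOp_pauliZ {N : ℕ} (k : Fin N) :
    restrict (siteOp pauliZ k) = 1 - (2 : ℂ) • nodeProj k := by
  ext a b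
  have hinj : (excitation a : Config N) = excitation b ↔ a = b := by
    refine ⟨fun h => ?_, fun h => by rw [h]⟩
    have := congrFun h a
    rw [excitation_apply, excitation_apply] at this
    by_contra hne
    simp [hne] at this
  rw [restrict, Matrix.submatrix_apply, siteOp_pauliZ, Matrix.diagonal_apply]
  simp only [hinj, nodeProj, Matrix.sub_apply, Matrix.smul_apply, Matrix.one_apply,
    Matrix.single_apply, excitation_apply]
  by_cases hab : a = b
  · subst hab
    by_cases hk : k = a
    · simp [hk, pauliZ]; norm_num
    · simp [hk, pauliZ]
  · have : ¬ (k = a ∧ k = b) := by rintro ⟨rfl, rfl⟩; exact hab rfl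
    simp [hab, this]

/-! ### The spectrum of the uniform chain -/

/-- Node `b` carries the value `f (b + 1)`. The zeros of `f` at the fictitious nodes `0` and `N + 1`
let the end nodes obey the same two-neighbour recurrence as the interior ones. -/
theorem sum_chainCoupling {N : ℕ} (g : ℝ) (f : ℕ → ℂ) (h0 : f 0 = 0) (hN : f (N + 1) = 0)
    (a : Fin N) :
    ∑ b : Fin N, ((chainCoupling g a b : ℝ) : ℂ) * f (b + 1) = g * (f a + f (a + 2)) := by
  have hsplit (b : Fin N) : ((chainCoupling g a b : ℝ) : ℂ) * f (b + 1) =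
      (if (b : ℕ) + 1 = a then g * f a else 0) + (if (b : ℕ) = a + 1 then g * f (a + 2) else 0) := by
    by_cases h1 : (b : ℕ) + 1 = a
    · have h2 : ¬ ((b : ℕ) = a + 1) := by omega
      simp [chainCoupling, h1, h2]
    · by_cases h2 : (b : ℕ) = a + 1
      · have h3 : ¬ ((a : ℕ) + 1 + 1 = a) := by omega
        simp [chainCoupling, h2, h3]
      · simp [chainCoupling, h1, h2, Ne.symm h2]
  simp only [hsplit, Finset.sum_add_distrib, mul_add]
  congr 1
  · rcases Nat.eq_zero_or_pos a with h | h
    · rw [h, h0]; simp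
    · rw [Finset.sum_eq_single ⟨(a : ℕ) - 1, by omega⟩]
      · simp only [if_pos (show (a : ℕ) - 1 + 1 = a by omega)]
      · intro b _ hb
        refine if_neg fun h' => hb (Fin.ext ?_)
        simp only; omega
      · simp
  · by_cases h : (a : ℕ) + 1 < N
    · rw [Finset.sum_eq_single ⟨(a : ℕ) + 1, h⟩]
      · simp
      · intro b _ hb
        exact if_neg fun h' => hb (Fin.ext h')
      · simp
    · have : (a : ℕ) + 2 = N + 1 := by omega
      rw [this, hN]; simp

theorem modeAngle_mem_Ioo {N : ℕ} (j : Fin N) : modeAngle j ∈ Set.Ioo 0 Real.pi := by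
  have hj : ((j : ℕ) : ℝ) + 1 < (N : ℝ) + 1 := by exact_mod_cast Nat.succ_lt_succ j.isLt
  have hN : (0 : ℝ) < (N : ℝ) + 1 := by positivity
  refine ⟨by unfold modeAngle; positivity, ?_⟩
  rw [modeAngle, div_lt_iff₀ hN, mul_comm]
  exact mul_lt_mul_of_pos_left hj Real.pi_pos

theorem modeAngle_injective {N : ℕ} : Function.Injective (modeAngle : Fin N → ℝ) := by
  intro i j h
  have hN : (N : ℝ) + 1 ≠ 0 := by positivity
  rw [modeAngle, modeAngle, div_left_inj' hN, mul_left_inj' Real.pi_ne_zero, add_left_inj] at h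
  exact Fin.ext (by exact_mod_cast h)

/-- The angles are distinct points of `(0, π)`, where cosine is injective; for `g ≠ 0` this makes
the spectrum simple. -/
theorem cos_modeAngle_injective {N : ℕ} :
    Function.Injective fun j : Fin N => Real.cos (modeAngle j) := fun i j h =>
  modeAngle_injective (Real.injOn_cos ⟨(modeAngle_mem_Ioo i).1.le, (modeAngle_mem_Ioo i).2.le⟩
    ⟨(modeAngle_mem_Ioo j).1.le, (modeAngle_mem_Ioo j).2.le⟩ h)

/-- The recurrence is `sin ((n - 1)θ) + sin ((n + 1)θ) = 2 cos θ sin (nθ)`. The boundary condition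
at `N + 1` holds because `(N + 1)θ` is a multiple of `π`. -/
theorem chain_mulVec_modeVector {N : ℕ} (g : ℝ) (j : Fin N) :
    restrict (xxChain N g) *ᵥ modeVector j =
      ((2 * g * Real.cos (modeAngle j) : ℝ) : ℂ) • modeVector j := by
  ext a
  set θ := modeAngle j with hθ
  have h := sum_chainCoupling g (fun n => ((Real.sin (n * θ) : ℝ) : ℂ)) (by simp) (by
    have : ((N + 1 : ℕ) : ℝ) * θ = ((j + 1 : ℕ) : ℝ) * Real.pi := by
      have hN : (N : ℝ) + 1 ≠ 0 := by positivity
      rw [hθ, modeAngle]; push_cast; field_simp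
    rw [this, Real.sin_nat_mul_pi, Complex.ofReal_zero]) a
  rw [restrict_xxChain, Matrix.mulVec, dotProduct]
  simp only [Matrix.of_apply, modeVector, Pi.smul_apply, smul_eq_mul]
  push_cast at h
  rw [← hθ]
  push_cast
  rw [h]
  have e1 : ((a : ℕ) : ℂ) * θ = ((a : ℕ) + 1) * θ - θ := by ring
  have e2 : (((a : ℕ) : ℂ) + 2) * θ = ((a : ℕ) + 1) * θ + θ := by ring
  rw [e1, e2, Complex.sin_sub, Complex.sin_add]
  ring

theorem modeVector_ne_zero {N : ℕ} (j : Fin N) : modeVector j ≠ 0 := by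
  intro h
  have hN : 0 < N := j.pos
  have := congrFun h ⟨0, hN⟩
  simp only [modeVector, Nat.cast_zero, zero_add, one_mul, Pi.zero_apply] at this
  exact (Real.sin_pos_of_mem_Ioo (modeAngle_mem_Ioo j)).ne' (by exact_mod_cast this)

theorem hasEigenvector_modeVector {N : ℕ} (g : ℝ) (j : Fin N) :
    Module.End.HasEigenvector (Matrix.toLin' (restrict (xxChain N g)))
      ((2 * g * Real.cos (modeAngle j) : ℝ) : ℂ) (modeVector j) :=
  Module.End.hasEigenvector_iff.mpr ⟨Module.End.mem_eigenspace_iff.mpr (by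
    rw [Matrix.toLin'_apply, chain_mulVec_modeVector]), modeVector_ne_zero j⟩

/-- An operator on an `n`-dimensional space with `n` distinct eigenvalues has no eigenvectors
besides the multiples of the given ones. -/
theorem exists_eq_smul_of_hasEigenvector {K V ι : Type*} [Field K] [AddCommGroup V] [Module K V]
    [FiniteDimensional K V] [Fintype ι] (f : Module.End K V) (μ : ι → K) (b : ι → V) (hμ : Function.Injective μ)
    (hb : ∀ i, f.HasEigenvector (μ i) (b i)) (hcard : Fintype.card ι = Module.finrank K V)
    {E : K} {v : V} (hv : f.HasEigenvector E v) : ∃ (i : ι) (c : K), v = c • b i := by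
  classical
  have hli : LinearIndependent K b := Module.End.eigenvectors_linearIndependent' f μ hμ b hb
  have : Nonempty ι := by
    by_contra h
    rw [not_nonempty_iff] at h
    rw [Fintype.card_eq_zero] at hcard
    have hspan := hli.span_eq_top_of_card_eq_finrank' (by rw [Fintype.card_eq_zero, hcard])
    rw [Set.range_eq_empty, Submodule.span_empty] at hspan
    exact hv.2 ((Submodule.mem_bot K).mp (hspan ▸ Submodule.mem_top))
  let B := basisOfLinearIndependentOfCardEqFinrank hli hcard
  have hB (i : ι) : B i = b i := by simp [B]
  -- Comparing coordinates in `f v = E • v`: a nonzero coordinate at `i` forces `μ i = E`, which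
  -- injectivity of `μ` allows for one `i` only.
  have hrepr (i : ι) : B.repr v i * μ i = E * B.repr v i := by
    have h1 : f v = ∑ i, (B.repr v i * μ i) • B i := by
      conv_lhs => rw [← B.sum_repr v]
      simp only [map_sum, map_smul, hB, (hb _).apply_eq_smul, smul_smul]
    rw [hv.apply_eq_smul] at h1
    have h2 := congrArg (fun w => B.repr w i) h1
    simp only [map_smul, Finsupp.smul_apply, smul_eq_mul, B.repr_sum_self] at h2
    exact h2.symm
  obtain ⟨i, hi⟩ : ∃ i, B.repr v i ≠ 0 := by
    by_contra! h
    exact hv.2 (B.repr.map_eq_zero_iff.mp (Finsupp.ext h))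
  have hE (j : ι) (hj : B.repr v j ≠ 0) : μ j = E := by
    have := hrepr j
    rw [mul_comm] at this
    exact mul_right_cancel₀ hj this
  refine ⟨i, B.repr v i, ?_⟩
  conv_lhs => rw [← B.sum_repr v]
  rw [Finset.sum_eq_single i, hB]
  · intro j _ hj
    by_cases h : B.repr v j = 0
    · rw [h, zero_smul]
    · exact absurd (hμ ((hE j h).trans (hE i hi).symm)) hj
  · simp

theorem exists_eq_smul_modeVector {N : ℕ} {g : ℝ} (hg : g ≠ 0) {E : ℂ} {v : Fin N → ℂ}
    (hv : Module.End.HasEigenvector (Matrix.toLin' (restrict (xxChain N g))) E v) :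
    ∃ (j : Fin N) (c : ℂ), v = c • modeVector j := by
  refine exists_eq_smul_of_hasEigenvector _ _ _ (fun i j h => cos_modeAngle_injective ?_)
    (hasEigenvector_modeVector g) (by simp) hv
  exact mul_left_cancel₀ (mul_ne_zero two_ne_zero hg) (Complex.ofReal_injective h)

/-- A mode has a node at `k` exactly when `k` and `N + 1` have a common divisor. -/
theorem exists_sin_eq_zero_iff {N : ℕ} (k : Fin N) :
    (∃ j : Fin N, Real.sin (((k : ℕ) + 1 : ℝ) * ((j : ℕ) + 1 : ℝ) * Real.pi / ((N : ℝ) + 1)) = 0) ↔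
      1 < Nat.gcd (N + 1) ((k : ℕ) + 1) := by
  have hN : (N : ℝ) + 1 ≠ 0 := by positivity
  have hdvd (j : Fin N) :
      Real.sin (((k : ℕ) + 1 : ℝ) * ((j : ℕ) + 1 : ℝ) * Real.pi / ((N : ℝ) + 1)) = 0 ↔
        N + 1 ∣ (k + 1) * (j + 1) := by
    rw [Real.sin_eq_zero_iff]
    constructor
    · rintro ⟨n, hn⟩
      rw [eq_div_iff hN] at hn
      have h : (n : ℝ) * (N + 1) = (k + 1) * (j + 1) :=
        mul_right_cancel₀ Real.pi_ne_zero (by linear_combination hn)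
      have h' : ((k + 1) * (j + 1) : ℤ) = (N + 1) * n := by
        have : (n : ℤ) * (N + 1) = (k + 1) * (j + 1) := by exact_mod_cast h
        rw [← this, mul_comm]
      exact_mod_cast (Dvd.intro n h'.symm : ((N : ℤ) + 1) ∣ (k + 1) * (j + 1))
    · rintro ⟨c, hc⟩
      refine ⟨c, ?_⟩
      have : ((k : ℕ) + 1 : ℝ) * ((j : ℕ) + 1) = (N + 1) * c := by exact_mod_cast hc
      rw [this]
      push_cast
      field_simp
  simp only [hdvd]
  have hpos : 0 < Nat.gcd (N + 1) ((k : ℕ) + 1) := Nat.gcd_pos_of_pos_left _ N.succ_pos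
  constructor
  · rintro ⟨j, hj⟩
    by_contra h
    have hc : Nat.Coprime (N + 1) (k + 1) := by rw [Nat.Coprime]; omega
    have := Nat.le_of_dvd (Nat.succ_pos _) (hc.dvd_of_dvd_mul_left hj)
    have := j.isLt
    omega
  · intro h
    obtain ⟨d, e, hd⟩ : ∃ d e, Nat.gcd (N + 1) ((k : ℕ) + 1) * e = N + 1 ∧
        Nat.gcd (N + 1) ((k : ℕ) + 1) * d = k + 1 := by
      obtain ⟨e, he⟩ := Nat.gcd_dvd_left (N + 1) ((k : ℕ) + 1)
      obtain ⟨d, hd⟩ := Nat.gcd_dvd_right (N + 1) ((k : ℕ) + 1)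
      exact ⟨d, e, he.symm, hd.symm⟩
    generalize Nat.gcd (N + 1) ((k : ℕ) + 1) = q at *
    have he : 0 < e := Nat.pos_of_ne_zero (by rintro rfl; simp at hd)
    have : e < N + 1 := by nlinarith [hd.1]
    -- The mode has number `e = (N + 1) / q`, hence index `e - 1`; `q > 1` keeps it below `N + 1`.
    refine ⟨⟨e - 1, by omega⟩, ?_⟩
    simp only [Nat.sub_add_cancel he]
    exact ⟨d, by rw [← hd.1, ← hd.2]; ring⟩

theorem exists_modeVector_eq_zero_iff {N : ℕ} (k : Fin N) :
    (∃ j : Fin N, modeVector j k = 0) ↔ 1 < Nat.gcd (N + 1) ((k : ℕ) + 1) := by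
  rw [← exists_sin_eq_zero_iff]
  refine exists_congr fun j => ?_
  rw [modeVector, Complex.ofReal_eq_zero, modeAngle, ← mul_div_assoc, ← mul_assoc]

/-! ### Lie algebras of matrices -/

/-- The matrices `X` whose skew-Hermitian components `X - Xᴴ` and `i (X + Xᴴ)` lie in `L`; for
`L ≤ 𝔲(N)` this is the complex span of `L`. -/
def complexification {N : ℕ} (L : LieSubalgebra ℝ (Matrix (Fin N) (Fin N) ℂ)) :
    LieSubalgebra ℂ (Matrix (Fin N) (Fin N) ℂ) where
  carrier := {X | X - Xᴴ ∈ L ∧ Complex.I • (X + Xᴴ) ∈ L}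
  zero_mem' := by simp
  add_mem' := by
    rintro X Y ⟨hX, hX'⟩ ⟨hY, hY'⟩
    refine ⟨?_, ?_⟩
    · convert L.add_mem hX hY using 1
      rw [Matrix.conjTranspose_add]; abel
    · convert L.add_mem hX' hY' using 1
      rw [Matrix.conjTranspose_add, ← smul_add]; congr 1; abel
  smul_mem' := by
    rintro c X ⟨hX, hX'⟩
    refine ⟨?_, ?_⟩
    -- With `A = X - Xᴴ` and `B = i (X + Xᴴ)`, so that `2X = A - iB`, multiplication by `a + bi`
    -- sends `(A, B)` to `(aA + bB, aB - bA)`.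
    · convert L.add_mem (L.smul_mem c.re hX) (L.smul_mem c.im hX') using 1
      ext i j
      obtain ⟨a, b⟩ := c
      have h : (⟨a, b⟩ : ℂ) = a + b * Complex.I := Complex.mk_eq_add_mul_I a b
      simp [h]
      ring
    · convert L.sub_mem (L.smul_mem c.re hX') (L.smul_mem c.im hX) using 1
      ext i j
      obtain ⟨a, b⟩ := c
      have h : (⟨a, b⟩ : ℂ) = a + b * Complex.I := Complex.mk_eq_add_mul_I a b
      simp [h]
      linear_combination (b * X i j - b * starRingEnd ℂ (X j i)) * Complex.I_mul_I
  lie_mem' := by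
    rintro X Y ⟨hX, hX'⟩ ⟨hY, hY'⟩
    have hX : X - Xᴴ ∈ L := hX
    have hY : Y - Yᴴ ∈ L := hY
    have hX' : Complex.I • (X + Xᴴ) ∈ L := hX'
    have hY' : Complex.I • (Y + Yᴴ) ∈ L := hY'
    refine ⟨?_, ?_⟩
    -- Expanding the bracket of `(A - iB) / 2` and `(A' - iB') / 2`, its components are `([A, A'] -
    -- [B, B']) / 2` and `([A, B'] + [B, A']) / 2`.
    · convert L.smul_mem (1 / 2 : ℝ) (L.sub_mem (L.lie_mem hX hY) (L.lie_mem hX' hY')) using 1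
      rw [lie_smul, smul_lie, smul_smul, Complex.I_mul_I, neg_one_smul, sub_neg_eq_add]
      simp only [Ring.lie_def, Matrix.conjTranspose_sub, Matrix.conjTranspose_mul]
      rw [eq_comm, one_div, inv_smul_eq_iff₀ two_ne_zero, two_smul]
      noncomm_ring
    · convert L.smul_mem (1 / 2 : ℝ) (L.add_mem (L.lie_mem hX hY') (L.lie_mem hX' hY)) using 1
      rw [lie_smul, smul_lie, ← smul_add, smul_comm]
      simp only [Ring.lie_def, Matrix.conjTranspose_sub, Matrix.conjTranspose_mul]
      congr 1
      rw [eq_comm, one_div, inv_smul_eq_iff₀ two_ne_zero, two_smul]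
      noncomm_ring

theorem mem_complexification {N : ℕ} {L : LieSubalgebra ℝ (Matrix (Fin N) (Fin N) ℂ)}
    {X : Matrix (Fin N) (Fin N) ℂ} :
    X ∈ complexification L ↔ X - Xᴴ ∈ L ∧ Complex.I • (X + Xᴴ) ∈ L := Iff.rfl

theorem mem_complexification_of_isHermitian {N : ℕ}
    {L : LieSubalgebra ℝ (Matrix (Fin N) (Fin N) ℂ)} {X : Matrix (Fin N) (Fin N) ℂ}
    (hX : X.IsHermitian) (h : Complex.I • X ∈ L) : X ∈ complexification L := by
  rw [mem_complexification, hX.eq, sub_self, smul_add]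
  exact ⟨L.zero_mem, L.add_mem h h⟩

/-- The descent to real coefficients: for skew-Hermitian `X` the component `X - Xᴴ` is `2X`. -/
theorem mem_of_mem_complexification {N : ℕ} {L : LieSubalgebra ℝ (Matrix (Fin N) (Fin N) ℂ)}
    {X : Matrix (Fin N) (Fin N) ℂ} (hX : X ∈ uLie N) (h : X ∈ complexification L) : X ∈ L := by
  have hX : Xᴴ = -X := hX
  have h1 := L.smul_mem (1 / 2 : ℝ) (mem_complexification.mp h).1
  rwa [hX, sub_neg_eq_add, ← two_smul ℝ, smul_smul, one_div, inv_mul_cancel₀ two_ne_zero,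
    one_smul] at h1

/-- The Lie algebra obtained by adjoining the scalar matrices. -/
def adjoinScalars {N : ℕ} (K : LieSubalgebra ℂ (Matrix (Fin N) (Fin N) ℂ)) :
    LieSubalgebra ℂ (Matrix (Fin N) (Fin N) ℂ) where
  carrier := {X | ∃ c : ℂ, X - c • (1 : Matrix (Fin N) (Fin N) ℂ) ∈ K}
  zero_mem' := ⟨0, by simp⟩
  add_mem' := by
    rintro X Y ⟨c, hc⟩ ⟨d, hd⟩
    refine ⟨c + d, ?_⟩
    convert K.add_mem hc hd using 1
    rw [add_smul]; abel
  smul_mem' := by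
    rintro a X ⟨c, hc⟩
    refine ⟨a * c, ?_⟩
    convert K.smul_mem a hc using 1
    rw [smul_sub, smul_smul]
  lie_mem' := by
    rintro X Y ⟨c, hc⟩ ⟨d, hd⟩
    refine ⟨0, ?_⟩
    convert K.lie_mem hc hd using 1
    simp [Ring.lie_def, sub_mul, mul_sub]
    module

/-- Scalar matrices are central, so adjoining them creates no new commutators. -/
theorem lie_mem_of_mem_adjoinScalars {N : ℕ} {K : LieSubalgebra ℂ (Matrix (Fin N) (Fin N) ℂ)}
    {X Y : Matrix (Fin N) (Fin N) ℂ} (hX : X ∈ adjoinScalars K) (hY : Y ∈ adjoinScalars K) :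
    ⁅X, Y⁆ ∈ K := by
  obtain ⟨c, hc⟩ := hX
  obtain ⟨d, hd⟩ := hY
  convert K.lie_mem hc hd using 1
  simp [Ring.lie_def, sub_mul, mul_sub]
  module

/-- Every traceless matrix is a sum of commutators. -/
theorem mem_of_trace_eq_zero {N : ℕ} {K : Submodule ℂ (Matrix (Fin N) (Fin N) ℂ)}
    (hK : ∀ X Y : Matrix (Fin N) (Fin N) ℂ, ⁅X, Y⁆ ∈ K) (k : Fin N)
    {X : Matrix (Fin N) (Fin N) ℂ} (hX : X.trace = 0) : X ∈ K := by
  -- `E_ii - E_kk = [E_ik, E_ki]`, and `E_ij = [E_ii, E_ij]` for `i ≠ j`. In the expansion of `X`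
  -- the `E_kk` corrections add up to the trace times `E_kk`, which is zero.
  have hunit (i j : Fin N) :
      Matrix.single i j 1 - (if i = j then Matrix.single k k (1 : ℂ) else 0) ∈ K := by
    by_cases hij : i = j
    · subst hij
      convert hK (Matrix.single i k 1) (Matrix.single k i 1) using 1
      simp [Ring.lie_def]
    · convert hK (Matrix.single i i 1) (Matrix.single i j 1) using 1
      simp [Ring.lie_def, hij, Ne.symm hij]
  have hsum : X = ∑ i, ∑ j, X i j •
      (Matrix.single i j 1 - (if i = j then Matrix.single k k (1 : ℂ) else 0)) := by
    have htr : ∑ i, X i i = 0 := hX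
    simp only [smul_sub, Finset.sum_sub_distrib, smul_ite, smul_zero, Finset.sum_ite_eq,
      Finset.mem_univ, if_true]
    rw [← Finset.sum_smul, htr, zero_smul, sub_zero]
    simp only [Matrix.smul_single, smul_eq_mul, mul_one]
    exact Matrix.matrix_eq_sum_single X
  rw [hsum]
  exact K.sum_mem fun i _ => K.sum_mem fun j _ => K.smul_mem _ (hunit i j)

/-! ### Rank-one matrices and generation of the full matrix algebra -/

theorem nodeProj_eq_vecMulVec {N : ℕ} (k : Fin N) :
    nodeProj k = Matrix.vecMulVec (Pi.single k 1) (Pi.single k 1) := by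
  rw [nodeProj, Matrix.single_eq_single_vecMulVec_single]

theorem isHermitian_nodeProj {N : ℕ} (k : Fin N) : (nodeProj k).IsHermitian := by
  simp [Matrix.IsHermitian, nodeProj]

/-- A submodule containing `e` and invariant under a symmetric matrix, no eigenvector of which is
orthogonal to `e`, is everything. -/
theorem eq_top_of_invariant {n : Type*} [Fintype n] [DecidableEq n] {H : Matrix n n ℂ}
    (hH : H.IsSymm) {e : n → ℂ}
    (he : ∀ (E : ℂ) (v : n → ℂ), Module.End.HasEigenvector (Matrix.toLin' H) E v → v ⬝ᵥ e ≠ 0)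
    {W : Submodule ℂ (n → ℂ)} (heW : e ∈ W) (hW : ∀ w ∈ W, H *ᵥ w ∈ W) : W = ⊤ := by
  by_contra hne
  obtain ⟨f, hf, hWf⟩ := W.exists_le_ker_of_lt_top (lt_top_iff_ne_top.mpr hne)
  -- The annihilator of `W` for the bilinear (not Hermitian) dot product. It is nonzero as `W` is
  -- proper, and `H`-invariant as `H` is symmetric, so it contains an eigenvector, which is
  -- orthogonal to `e`.
  let U : Submodule ℂ (n → ℂ) :=
    { carrier := {u | ∀ w ∈ W, u ⬝ᵥ w = 0}
      zero_mem' := fun w _ => zero_dotProduct w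
      add_mem' := fun hu hv w hw => by rw [add_dotProduct, hu w hw, hv w hw, add_zero]
      smul_mem' := fun c u hu w hw => by rw [smul_dotProduct, hu w hw, smul_zero] }
  have hfu (w : n → ℂ) : (fun i => f (Pi.single i 1)) ⬝ᵥ w = f w := by
    conv_rhs => rw [pi_eq_sum_univ' w, map_sum]
    simp only [dotProduct, map_smul, smul_eq_mul]
    exact Finset.sum_congr rfl fun i _ => mul_comm _ _
  have hmem : (fun i => f (Pi.single i 1)) ∈ U := fun w hw => by
    rw [hfu]; exact hWf hw
  have : Nontrivial U := by
    refine ⟨⟨⟨_, hmem⟩, 0, fun h => hf (LinearMap.ext fun w => ?_)⟩⟩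
    rw [← hfu w, show (fun i => f (Pi.single i 1)) = 0 from congrArg Subtype.val h]
    simp
  have hUinv : ∀ u ∈ U, Matrix.toLin' H u ∈ U := fun u hu w hw => by
    rw [Matrix.toLin'_apply, ← Matrix.vecMul_transpose, hH.eq, ← Matrix.dotProduct_mulVec]
    exact hu _ (hW w hw)
  obtain ⟨E, hE⟩ := Module.End.exists_eigenvalue ((Matrix.toLin' H).restrict hUinv)
  obtain ⟨u, hu⟩ := hE.exists_hasEigenvector
  refine he E u (Module.End.hasEigenvector_iff.mpr ⟨Module.End.mem_eigenspace_iff.mpr ?_, ?_⟩)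
    (u.2 e heW)
  · exact congrArg Subtype.val hu.apply_eq_smul
  · exact fun h => hu.2 (Subtype.ext h)

/-- A complex Lie algebra containing a symmetric matrix `H` and the projection onto a unit vector
orthogonal to no eigenvector of `H` contains all matrices. -/
theorem lieSubalgebra_eq_top {N : ℕ} {H : Matrix (Fin N) (Fin N) ℂ} (hH : H.IsSymm)
    {e : Fin N → ℂ} (hee : e ⬝ᵥ e = 1)
    (he : ∀ (E : ℂ) (v : Fin N → ℂ), Module.End.HasEigenvector (Matrix.toLin' H) E v → v ⬝ᵥ e ≠ 0)
    {K : LieSubalgebra ℂ (Matrix (Fin N) (Fin N) ℂ)} (hHK : H ∈ K)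
    (hPK : Matrix.vecMulVec e e ∈ K) : K = ⊤ := by
  let W : Submodule ℂ (Fin N → ℂ) :=
    { carrier := {w | Matrix.vecMulVec w e ∈ K ∧ Matrix.vecMulVec e w ∈ K}
      zero_mem' := by simp
      add_mem' := fun hu hv => ⟨by rw [Matrix.add_vecMulVec]; exact K.add_mem hu.1 hv.1,
        by rw [Matrix.vecMulVec_add]; exact K.add_mem hu.2 hv.2⟩
      smul_mem' := fun c u hu => ⟨by rw [Matrix.smul_vecMulVec]; exact K.smul_mem c hu.1,
        by rw [Matrix.vecMulVec_smul]; exact K.smul_mem c hu.2⟩ }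
  have hvec (w : Fin N → ℂ) : w ᵥ* H = H *ᵥ w := by
    conv_rhs => rw [← Matrix.vecMul_transpose, hH.eq]
  -- `[w eᵀ, e uᵀ] = w uᵀ - (u ⬝ᵥ w) e eᵀ`, because `e ⬝ᵥ e = 1`.
  have hWW {w u : Fin N → ℂ} (hw : w ∈ W) (hu : u ∈ W) : Matrix.vecMulVec w u ∈ K := by
    convert K.add_mem (K.lie_mem hw.1 hu.2) (K.smul_mem (u ⬝ᵥ w) hPK) using 1
    rw [Ring.lie_def, Matrix.vecMulVec_mul_vecMulVec, Matrix.vecMulVec_mul_vecMulVec, hee, one_smul,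
      Matrix.vecMulVec_smul, sub_add_cancel]
  have heW : e ∈ W := ⟨hPK, hPK⟩
  -- With `P = e eᵀ`, `[P, [H, P]] = 2PHP - PH - HP` and `PHP` is a multiple of `P`, so `HP + PH`
  -- lies in `K`. Together with `[H, P] = HP - PH` this separates `HP = (He) eᵀ` from `PH = e
  -- (He)ᵀ`.
  have hHe : H *ᵥ e ∈ W := by
    have h1 := K.lie_mem hHK hPK
    have h2 := K.lie_mem hPK h1
    rw [Ring.lie_def] at h1
    rw [Ring.lie_def, Ring.lie_def] at h2
    simp only [Matrix.mul_vecMulVec, Matrix.vecMulVec_mul, hvec] at h1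
    simp only [mul_sub, sub_mul, Matrix.mul_vecMulVec, Matrix.vecMulVec_mul, hvec,
      Matrix.vecMulVec_mulVec] at h2
    have hc : H *ᵥ e ⬝ᵥ e = e ⬝ᵥ H *ᵥ e := dotProduct_comm _ _
    simp only [hee, hc, one_smul, MulOpposite.op_one, op_smul_eq_smul, Matrix.smul_vecMulVec] at h2
    have h3 := K.sub_mem (K.smul_mem (2 * (e ⬝ᵥ H *ᵥ e)) hPK) h2
    constructor
    · convert K.smul_mem (1 / 2 : ℂ) (K.add_mem h3 h1) using 1
      module
    · convert K.smul_mem (1 / 2 : ℂ) (K.sub_mem h3 h1) using 1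
      module
  -- `[H, w eᵀ] = (Hw) eᵀ - w (He)ᵀ`, whose last term is in `K` by `hWW`; likewise for `e wᵀ`.
  have hW : W = ⊤ := eq_top_of_invariant hH he heW fun w hw => by
    have h1 := K.lie_mem hHK hw.1
    have h2 := K.lie_mem hHK hw.2
    rw [Ring.lie_def, Matrix.mul_vecMulVec, Matrix.vecMulVec_mul, hvec] at h1 h2
    constructor
    · convert K.add_mem h1 (hWW hw hHe) using 1
      rw [sub_add_cancel]
    · convert K.sub_mem (hWW hHe hw) h2 using 1
      rw [sub_sub_cancel]
  refine eq_top_iff.mpr fun X _ => ?_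
  rw [Matrix.matrix_eq_sum_single X]
  refine K.sum_mem fun i _ => K.sum_mem fun j _ => ?_
  rw [← mul_one (X i j), ← smul_eq_mul, ← Matrix.smul_single,
    Matrix.single_eq_single_vecMulVec_single]
  exact K.smul_mem _ (hWW (hW ▸ Submodule.mem_top) (hW ▸ Submodule.mem_top))

/-! ### Dynamical Lie algebras between `𝔰𝔲(N)` and `𝔲(N)` -/

theorem dynLie_le_uLie {N : ℕ} {A B : Matrix (Fin N) (Fin N) ℂ} (hA : A.IsHermitian)
    (hB : B.IsHermitian) : dynLie A B ≤ uLie N := by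
  have h {X : Matrix (Fin N) (Fin N) ℂ} (hX : X.IsHermitian) : Complex.I • X ∈ uLie N := by
    change (Complex.I • X)ᴴ = -(Complex.I • X)
    rw [Matrix.conjTranspose_smul, hX.eq]
    simp
  refine LieSubalgebra.lieSpan_le.mpr ?_
  rintro X (rfl | rfl)
  exacts [h hA, h hB]

theorem left_mem_dynLie {N : ℕ} (A B : Matrix (Fin N) (Fin N) ℂ) : Complex.I • A ∈ dynLie A B :=
  LieSubalgebra.subset_lieSpan (Or.inl rfl)

theorem right_mem_dynLie {N : ℕ} (A B : Matrix (Fin N) (Fin N) ℂ) : Complex.I • B ∈ dynLie A B :=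
  LieSubalgebra.subset_lieSpan (Or.inr rfl)

theorem suLie_le_uLie (N : ℕ) : suLie N ≤ uLie N := fun _ h => h.1

/-- `𝔰𝔲(N)` has codimension one in `𝔲(N)`. -/
theorem eq_uLie_or_eq_suLie {N : ℕ} {L : LieSubalgebra ℝ (Matrix (Fin N) (Fin N) ℂ)}
    (hsu : suLie N ≤ L) (hu : L ≤ uLie N) : L = uLie N ∨ L = suLie N := by
  by_cases h : L ≤ suLie N
  · exact Or.inr (le_antisymm h hsu)
  · left
    refine le_antisymm hu fun B hB => ?_
    obtain ⟨A, hA, hA'⟩ := SetLike.not_le_iff_exists.mp h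
    have htr : A.trace ≠ 0 := fun h0 => hA' ⟨hu hA, h0⟩
    -- Traces of skew-Hermitian matrices are purely imaginary, so the ratio of two of them is real
    -- and may be used as a coefficient over `ℝ`.
    have him {X : Matrix (Fin N) (Fin N) ℂ} (hX : X ∈ uLie N) : X.trace = X.trace.im * Complex.I := by
      have hX : Xᴴ = -X := hX
      have h1 := Matrix.trace_conjTranspose X
      rw [hX, Matrix.trace_neg] at h1
      have h2 := congrArg Complex.re h1
      simp only [Complex.neg_re, RCLike.star_def, Complex.conj_re] at h2
      apply Complex.ext
      · simp; linarith
      · simp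
    have hA0 : (A.trace.im : ℂ) ≠ 0 := fun h0 => htr (by rw [him (hu hA), h0, zero_mul])
    have hmem : B - (B.trace.im / A.trace.im) • A ∈ suLie N := by
      refine ⟨(uLie N).sub_mem hB ((uLie N).smul_mem _ (hu hA)), ?_⟩
      rw [Matrix.trace_sub, Matrix.trace_smul, him hB, him (hu hA), Complex.real_smul]
      push_cast
      simp
      field_simp
      simp
    have := L.add_mem (hsu hmem) (L.smul_mem (B.trace.im / A.trace.im) hA)
    rwa [sub_add_cancel] at this

/-- There is no external symmetry when the dynamical Lie algebra contains `𝔰𝔲(N)`. -/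
theorem not_hasExternalSymmetry {N : ℕ} {A B : Matrix (Fin N) (Fin N) ℂ}
    (h : suLie N ≤ dynLie A B) : ¬ HasExternalSymmetry A B := by
  rintro ⟨S, -, hA, hB, hS⟩
  -- The centralizer of `S` is a Lie algebra containing both generators, hence `dynLie A B` and with
  -- it `𝔰𝔲(N)`.
  let C : LieSubalgebra ℝ (Matrix (Fin N) (Fin N) ℂ) :=
    { carrier := {X | Commute X S}
      zero_mem' := Commute.zero_left S
      add_mem' := fun hX hY => Commute.add_left hX hY
      smul_mem' := fun c X hX => Commute.smul_left hX c
      lie_mem' := fun {X Y} hX hY => by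
        have hX : Commute X S := hX
        have hY : Commute Y S := hY
        change Commute ⁅X, Y⁆ S
        rw [Ring.lie_def]
        exact (hX.mul_left hY).sub_left (hY.mul_left hX) }
  have hC : suLie N ≤ C := h.trans (LieSubalgebra.lieSpan_le.mpr (by
    rintro X (rfl | rfl)
    exacts [Commute.smul_left hA _, Commute.smul_left hB _]))
  -- A traceless `X` is a complex combination of two elements of `𝔰𝔲(N)`. Applied to off-diagonal
  -- matrix units, this forces `S` to be scalar.
  have hcomm {X : Matrix (Fin N) (Fin N) ℂ} (hX : X.trace = 0) : Commute X S := by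
    have h1 : Commute (X - Xᴴ) S := hC ⟨by
      change (X - Xᴴ)ᴴ = -(X - Xᴴ)
      simp, by simp [Matrix.trace_conjTranspose, hX]⟩
    have h2 : Commute (Complex.I • (X + Xᴴ)) S := hC ⟨by
      change (Complex.I • (X + Xᴴ))ᴴ = -(Complex.I • (X + Xᴴ))
      simp [add_comm], by simp [Matrix.trace_conjTranspose, hX]⟩
    have hX2 : X = (1 / 2 : ℂ) • (X - Xᴴ - Complex.I • Complex.I • (X + Xᴴ)) := by
      rw [smul_smul, Complex.I_mul_I]
      module
    rw [hX2]
    exact (h1.sub_left (h2.smul_left Complex.I)).smul_left (1 / 2 : ℂ)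
  obtain ⟨c, hc⟩ := Matrix.mem_range_scalar_of_commute_single (M := S) fun i j hij =>
    hcomm (by simp [hij])
  refine hS ⟨c, ?_⟩
  rw [← hc, Matrix.scalar_apply, Matrix.smul_one_eq_diagonal]

/-! ### Controllability of the uniform chain -/

theorem isSymm_chain (N : ℕ) (g : ℝ) : (restrict (xxChain N g)).IsSymm := by
  ext a b
  simp only [restrict_xxChain, Matrix.transpose_apply, Matrix.of_apply, chainCoupling, or_comm]

theorem isHermitian_chain (N : ℕ) (g : ℝ) : (restrict (xxChain N g)).IsHermitian := by
  ext a b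
  simp only [restrict_xxChain, Matrix.conjTranspose_apply, Matrix.of_apply, chainCoupling,
    or_comm, RCLike.star_def, Complex.conj_ofReal]

theorem isHermitian_pauliZ {N : ℕ} (k : Fin N) : (restrict (siteOp pauliZ k)).IsHermitian := by
  rw [restrict_siteOp_pauliZ, Matrix.IsHermitian, Matrix.conjTranspose_sub,
    Matrix.conjTranspose_smul, (isHermitian_nodeProj k).eq]
  simp

theorem lieSubalgebra_eq_top_of_chain_mem {N : ℕ} {g : ℝ} (hg : g ≠ 0) {k : Fin N}
    (hk : ∀ j : Fin N, modeVector j k ≠ 0)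
    {K : LieSubalgebra ℂ (Matrix (Fin N) (Fin N) ℂ)} (hH : restrict (xxChain N g) ∈ K)
    (hP : nodeProj k ∈ K) : K = ⊤ := by
  refine lieSubalgebra_eq_top (isSymm_chain N g) (e := Pi.single k 1) (by simp) ?_ hH
    (nodeProj_eq_vecMulVec k ▸ hP)
  intro E v hv h
  obtain ⟨j, c, rfl⟩ := exists_eq_smul_modeVector hg hv
  rw [dotProduct_single_one, Pi.smul_apply, smul_eq_mul] at h
  exact hv.2 (by rw [(mul_eq_zero.mp h).resolve_right (hk j), zero_smul])

theorem dynLie_nodeProj_eq_uLie {N : ℕ} {g : ℝ} (hg : g ≠ 0) {k : Fin N}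
    (hk : ∀ j : Fin N, modeVector j k ≠ 0) :
    dynLie (restrict (xxChain N g)) (nodeProj k) = uLie N := by
  refine le_antisymm (dynLie_le_uLie (isHermitian_chain N g) (isHermitian_nodeProj k))
    fun X hX => mem_of_mem_complexification hX ?_
  rw [lieSubalgebra_eq_top_of_chain_mem hg hk
    (mem_complexification_of_isHermitian (isHermitian_chain N g) (left_mem_dynLie _ _))
    (mem_complexification_of_isHermitian (isHermitian_nodeProj k) (right_mem_dynLie _ _))]
  exact LieSubalgebra.mem_top X

/-- The projection `P = 1/2 - Z/2` need not lie in the complexified algebra, but it does after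
scalars are adjoined. The enlarged algebra is everything, its commutators lie in the original one,
and they span the traceless matrices. -/
theorem isControllable_pauliZ {N : ℕ} {g : ℝ} (hg : g ≠ 0) {k : Fin N}
    (hk : ∀ j : Fin N, modeVector j k ≠ 0) :
    IsControllable (restrict (xxChain N g)) (restrict (siteOp pauliZ k)) := by
  set L := dynLie (restrict (xxChain N g)) (restrict (siteOp pauliZ k)) with hL
  have hH : restrict (xxChain N g) ∈ complexification L :=
    mem_complexification_of_isHermitian (isHermitian_chain N g) (left_mem_dynLie _ _)
  have hZ : restrict (siteOp pauliZ k) ∈ complexification L :=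
    mem_complexification_of_isHermitian (isHermitian_pauliZ k) (right_mem_dynLie _ _)
  have htop : adjoinScalars (complexification L) = ⊤ :=
    lieSubalgebra_eq_top_of_chain_mem hg hk ⟨0, by rwa [zero_smul, sub_zero]⟩ ⟨1 / 2, by
      convert (complexification L).smul_mem (-1 / 2 : ℂ) hZ using 1
      rw [restrict_siteOp_pauliZ]
      module⟩
  have hmem (X : Matrix (Fin N) (Fin N) ℂ) : X ∈ adjoinScalars (complexification L) :=
    htop ▸ LieSubalgebra.mem_top X
  refine eq_uLie_or_eq_suLie (fun X hX => mem_of_mem_complexification hX.1 ?_)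
    (dynLie_le_uLie (isHermitian_chain N g) (isHermitian_pauliZ k))
  exact mem_of_trace_eq_zero (K := (complexification L).toSubmodule)
    (fun X Y => lie_mem_of_mem_adjoinScalars (hmem X) (hmem Y)) k hX.2

/-- A mode with a node at `k` gives an external symmetry. -/
theorem hasExternalSymmetry_nodeProj {N : ℕ} (g : ℝ) {j k : Fin N} (h : modeVector j k = 0) :
    HasExternalSymmetry (restrict (xxChain N g)) (nodeProj k) := by
  refine ⟨Matrix.vecMulVec (modeVector j) (modeVector j), ?_, ?_, ?_, ?_⟩
  · ext a b
    simp only [Matrix.conjTranspose_apply, Matrix.vecMulVec_apply, modeVector, star_mul',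
      RCLike.star_def, Complex.conj_ofReal]
    exact mul_comm _ _
  · rw [commute_iff_eq, Matrix.mul_vecMulVec, Matrix.vecMulVec_mul, ← Matrix.mulVec_transpose,
      (isSymm_chain N g).eq, chain_mulVec_modeVector, Matrix.smul_vecMulVec, Matrix.vecMulVec_smul]
  · rw [nodeProj_eq_vecMulVec, commute_iff_eq, Matrix.vecMulVec_mul_vecMulVec,
      Matrix.vecMulVec_mul_vecMulVec, single_one_dotProduct, dotProduct_single_one, h]
    simp
  -- The `(k, k)` entry of `v vᵀ` vanishes, so `c = 0`; the other diagonal entries `v_i ^ 2` then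
  -- give `v = 0`.
  · rintro ⟨c, hc⟩
    have hkk := congrFun (congrFun hc k) k
    simp only [Matrix.vecMulVec_apply, h, Matrix.smul_apply, Matrix.one_apply_eq, smul_eq_mul,
      mul_zero, mul_one] at hkk
    rw [← hkk, zero_smul] at hc
    refine modeVector_ne_zero j (funext fun i => ?_)
    have := congrFun (congrFun hc i) i
    simpa [Matrix.vecMulVec_apply] using this

theorem hasExternalSymmetry_pauliZ_iff {N : ℕ} (H : Matrix (Fin N) (Fin N) ℂ) (k : Fin N) :
    HasExternalSymmetry H (restrict (siteOp pauliZ k)) ↔ HasExternalSymmetry H (nodeProj k) := by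
  refine exists_congr fun S => and_congr_right fun _ => and_congr_right fun _ =>
    and_congr_left fun _ => ?_
  rw [restrict_siteOp_pauliZ]
  constructor
  · intro h
    have h1 := ((Commute.one_left S).sub_left h).smul_left (1 / 2 : ℂ)
    rwa [sub_sub_cancel, smul_smul, one_div, inv_mul_cancel₀ two_ne_zero, one_smul] at h1
  · intro h
    exact (Commute.one_left S).sub_left (h.smul_left 2)

theorem suLie_le_of_isControllable {N : ℕ} {A B : Matrix (Fin N) (Fin N) ℂ}
    (h : IsControllable A B) : suLie N ≤ dynLie A B := by
  rcases h with h | h <;> rw [h]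
  exact suLie_le_uLie N

end SpinChain

end

theorem theorem9 (N : ℕ) (g : ℝ) (hg : g ≠ 0) (k : Fin N) :
    -- controllability with the control `Z_k` restricted to the single-excitation subspace
    (SpinChain.IsControllable (SpinChain.restrict (SpinChain.xxChain N g))
        (SpinChain.restrict (SpinChain.siteOp SpinChain.pauliZ k)) ↔
      Nat.gcd (N + 1) ((k : ℕ) + 1) = 1) ∧
    -- with the control `z_k = i |k⟩⟨k|` the dynamical Lie algebra is `𝔲(N)`
    (SpinChain.dynLie (SpinChain.restrict (SpinChain.xxChain N g)) (SpinChain.nodeProj k) =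
        SpinChain.uLie N ↔
      Nat.gcd (N + 1) ((k : ℕ) + 1) = 1) ∧
    -- absence of external symmetry, for either form of the control
    (¬ SpinChain.HasExternalSymmetry (SpinChain.restrict (SpinChain.xxChain N g))
        (SpinChain.restrict (SpinChain.siteOp SpinChain.pauliZ k)) ↔
      Nat.gcd (N + 1) ((k : ℕ) + 1) = 1) ∧
    (¬ SpinChain.HasExternalSymmetry (SpinChain.restrict (SpinChain.xxChain N g))
        (SpinChain.nodeProj k) ↔
      Nat.gcd (N + 1) ((k : ℕ) + 1) = 1) ∧
    -- the sine vectors are eigenvectors, and up to scalars there are no others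
    (∀ j : Fin N, Module.End.HasEigenvector
        (Matrix.toLin' (SpinChain.restrict (SpinChain.xxChain N g)))
        ((2 * g * Real.cos (SpinChain.modeAngle j) : ℝ) : ℂ) (SpinChain.modeVector j)) ∧
    (∀ (E : ℂ) (v : Fin N → ℂ), Module.End.HasEigenvector
        (Matrix.toLin' (SpinChain.restrict (SpinChain.xxChain N g))) E v →
      ∃ (j : Fin N) (c : ℂ), v = c • SpinChain.modeVector j) ∧
    -- some sine eigenvector has a vanishing `k`-th entry exactly when the gcd exceeds 1
    ((∃ j : Fin N, Real.sin (((k : ℕ) + 1 : ℝ) * ((j : ℕ) + 1 : ℝ) * Real.pi / ((N : ℝ) + 1)) = 0) ↔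
      1 < Nat.gcd (N + 1) ((k : ℕ) + 1)) := by
  have hpos : 0 < Nat.gcd (N + 1) ((k : ℕ) + 1) := Nat.gcd_pos_of_pos_left _ N.succ_pos
  have hnode := SpinChain.exists_modeVector_eq_zero_iff k
  have hk (h : Nat.gcd (N + 1) ((k : ℕ) + 1) = 1) (j : Fin N) : SpinChain.modeVector j k ≠ 0 :=
    fun h0 => (hnode.mp ⟨j, h0⟩).ne' h
  have hsymm (h : ¬ SpinChain.HasExternalSymmetry (SpinChain.restrict (SpinChain.xxChain N g))
      (SpinChain.nodeProj k)) : Nat.gcd (N + 1) ((k : ℕ) + 1) = 1 := by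
    by_contra h1
    obtain ⟨j, hj⟩ := hnode.mpr (by omega)
    exact h (SpinChain.hasExternalSymmetry_nodeProj g hj)
  have hP (h : SpinChain.dynLie (SpinChain.restrict (SpinChain.xxChain N g))
      (SpinChain.nodeProj k) = SpinChain.uLie N) :
      ¬ SpinChain.HasExternalSymmetry (SpinChain.restrict (SpinChain.xxChain N g))
        (SpinChain.nodeProj k) :=
    SpinChain.not_hasExternalSymmetry (h ▸ SpinChain.suLie_le_uLie N)
  -- All the equivalences close one cycle: coprimality gives controllability, which excludes
  -- symmetries, which by `hsymm` gives coprimality.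
  refine ⟨⟨fun h => hsymm ?_, fun h => SpinChain.isControllable_pauliZ hg (hk h)⟩,
    ⟨fun h => hsymm (hP h), fun h => SpinChain.dynLie_nodeProj_eq_uLie hg (hk h)⟩, ?_,
    ⟨hsymm, fun h => hP (SpinChain.dynLie_nodeProj_eq_uLie hg (hk h))⟩,
    SpinChain.hasEigenvector_modeVector g, fun E v => SpinChain.exists_eq_smul_modeVector hg,
    SpinChain.exists_sin_eq_zero_iff k⟩
  · rw [← SpinChain.hasExternalSymmetry_pauliZ_iff]
    exact SpinChain.not_hasExternalSymmetry (SpinChain.suLie_le_of_isControllable h)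
  · rw [SpinChain.hasExternalSymmetry_pauliZ_iff]
    exact ⟨hsymm, fun h => hP (SpinChain.dynLie_nodeProj_eq_uLie hg (hk h))⟩
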